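/- Let $n\ge 1$ be an integer, let $a<0$ and let $c=n\pi/2$. For a symmetric $n\times n$ matrix $A$ with eigenvalues $\lambda_1,\dots,\lambda_n$ (with multiplicity) write $\theta(A)=\sum_{i=1}^n\arctan\lambda_i$, and write $B_r\subset\mathbb R^n$ for the open ball of radius $r$ centered at the origin. Then there exist $r>0$, depending on $n$ and $a$, and a convex function $u:B_r\to\mathbb R$ such that: 1. $u$ is a viscosity solution on $B_r$ of the rotator equation $$\theta(D^2u)=c+\frac a2\left(|x|^2+|Du|^2\right),$$ i.e. $u$ is continuous on $B_r$ and, whenever $x_0\in B_r$ and $\varphi$ is a function that is $C^2$ near $x_0$ with $\varphi(x_0)=u(x_0)$, one has $\theta(D^2\varphi(x_0))\ge c+\frac a2(|x_0|^2+|D\varphi(x_0)|^2)$ if $\varphi\ge u$ near $x_0$, and $\theta(D^2\varphi(x_0))\le c+\frac a2(|x_0|^2+|D\varphi(x_0)|^2)$ if $\varphi\le u$ near $x_0$; 2. $u\in C^{1,1/3}(B_r)$, i.e. $u$ is $C^1$ on $B_r$ and $Du$ is uniformly Hölder continuous on $B_r$ with exponent $1/3$; 3. $u\in C^\infty(B_r\setminus\{0\})$;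 4. $u$ is singular at the origin: $Du$ is not differentiable at $0$ (in particular $u$ is not $C^2$ in any neighborhood of $0$). -/

import Mathlib

open scoped NNReal ContDiff Topology

/-- The Lagrangian angle `tr arctan A = ∑ arctan λᵢ`, the sum running over the real eigenvalues of
`A` with multiplicity, i.e. over the real roots of the characteristic polynomial. For a symmetric
matrix these are all `n` eigenvalues, see `lagrangianAngle_eq_sum`. -/
noncomputable def lagrangianAngle {n : ℕ} (A : Matrix (Fin n) (Fin n) ℝ) : ℝ :=
  (A.charpoly.roots.map Real.arctan).sum

theorem lagrangianAngle_eq_sum {n : ℕ} {A : Matrix (Fin n) (Fin n) ℝ} (hA : A.IsHermitian) :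
    lagrangianAngle A = ∑ i, Real.arctan (hA.eigenvalues i) := by
  rw [lagrangianAngle, hA.roots_charpoly_eq_eigenvalues]
  simp [List.sum_ofFn]

/-- The Hessian matrix `(∂ᵢ∂ⱼ φ)(x)`. -/
noncomputable def hessianMatrix {n : ℕ} (φ : EuclideanSpace ℝ (Fin n) → ℝ)
    (x : EuclideanSpace ℝ (Fin n)) : Matrix (Fin n) (Fin n) ℝ :=
  Matrix.of fun i j =>
    fderiv ℝ (fderiv ℝ φ) x (EuclideanSpace.single i 1) (EuclideanSpace.single j 1)

/-- `u` is a viscosity subsolution of `∑ arctan λᵢ(D²u) = ψ(x, u, Du)` on `Ω`: every `C²` function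
touching `u` from above at a point `x₀` of `Ω` satisfies
`∑ arctan λᵢ(D²φ(x₀)) ≥ ψ(x₀, u(x₀), Dφ(x₀))`. -/
def IsViscositySubsolution {n : ℕ}
    (ψ : EuclideanSpace ℝ (Fin n) → ℝ → EuclideanSpace ℝ (Fin n) → ℝ)
    (Ω : Set (EuclideanSpace ℝ (Fin n))) (u : EuclideanSpace ℝ (Fin n) → ℝ) : Prop :=
  ∀ x₀ ∈ Ω, ∀ φ : EuclideanSpace ℝ (Fin n) → ℝ, ContDiffAt ℝ 2 φ x₀ →
    φ x₀ = u x₀ → (∀ᶠ x in 𝓝 x₀, u x ≤ φ x) →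
    ψ x₀ (u x₀) (gradient φ x₀) ≤ lagrangianAngle (hessianMatrix φ x₀)

/-- `u` is a viscosity supersolution of `∑ arctan λᵢ(D²u) = ψ(x, u, Du)` on `Ω`: every `C²` function
touching `u` from below at a point `x₀` of `Ω` satisfies
`∑ arctan λᵢ(D²φ(x₀)) ≤ ψ(x₀, u(x₀), Dφ(x₀))`. -/
def IsViscositySupersolution {n : ℕ}
    (ψ : EuclideanSpace ℝ (Fin n) → ℝ → EuclideanSpace ℝ (Fin n) → ℝ)
    (Ω : Set (EuclideanSpace ℝ (Fin n))) (u : EuclideanSpace ℝ (Fin n) → ℝ) : Prop :=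
  ∀ x₀ ∈ Ω, ∀ φ : EuclideanSpace ℝ (Fin n) → ℝ, ContDiffAt ℝ 2 φ x₀ →
    φ x₀ = u x₀ → (∀ᶠ x in 𝓝 x₀, φ x ≤ u x) →
    lagrangianAngle (hessianMatrix φ x₀) ≤ ψ x₀ (u x₀) (gradient φ x₀)

/-- A continuous viscosity solution of `∑ arctan λᵢ(D²u) = ψ(x, u, Du)` on an open set `Ω`. -/
def IsViscositySolution {n : ℕ}
    (ψ : EuclideanSpace ℝ (Fin n) → ℝ → EuclideanSpace ℝ (Fin n) → ℝ)
    (Ω : Set (EuclideanSpace ℝ (Fin n))) (u : EuclideanSpace ℝ (Fin n) → ℝ) : Prop :=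
  ContinuousOn u Ω ∧ IsViscositySubsolution ψ Ω u ∧ IsViscositySupersolution ψ Ω u

/-- The Hölder class `C^{1,α}(Ω)` for a bounded open convex set `Ω` (such as a ball): `u` is `C¹` on
`Ω` and its gradient is uniformly `α`-Hölder there (so `u` and `Du` are automatically bounded). -/
def IsC1Holder {n : ℕ} (α : ℝ≥0) (Ω : Set (EuclideanSpace ℝ (Fin n)))
    (u : EuclideanSpace ℝ (Fin n) → ℝ) : Prop :=
  ContDiffOn ℝ 1 u Ω ∧ ∃ C : ℝ≥0, HolderOnWith C α (gradient u) Ω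

/-- The right-hand side `c + (a/2)(|x|² + |Du|²)` of the rotator equation. -/
noncomputable def rotatorPhase {n : ℕ} (a c : ℝ) (x : EuclideanSpace ℝ (Fin n)) (_s : ℝ)
    (p : EuclideanSpace ℝ (Fin n)) : ℝ :=
  c + a / 2 * (‖x‖ ^ 2 + ‖p‖ ^ 2)

/-! Look for a radial solution `u = U(|x|)` with `U' = h` and put `β = -a/2 > 0`. The Hessian has
eigenvalues `h'` (once) and `h/s` (`n - 1` times), so the equation becomes `arctan h' + (n-1) arctan
(h/s) = nπ/2 - β(s² + h²)`. Write the graph of `h` in polar form, `(s, h) = R (sin φ, cos φ)`, with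
`φ` measured from the vertical axis. Then `arctan (h/s) = π/2 - φ`, and the equation turns into `R
φ' = tan (β R² - n φ)`, in which `h` no longer appears.

This ODE is singular at `R = 0`. Its linear part `R φ' + n φ = β R²` has the solution `β R²/(n+2)`,
and the factor `R^(n-1)` turns the full equation into an integral equation that is a contraction
near zero (`exists_singular_fixedPoint`); `singular_bounds` shows that `φ` stays comparable to `R²`.
Hence `s = R sin φ` is of order `R³` while `h` is of order `R`, so `h` is of order `s^(1/3)`: this
gives the exponent 1/3 and the infinite slope at the origin (`exists_profile`).

Off the origin `u` is a smooth classical solution, hence a viscosity solution because the Lagrangian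
angle is monotone in the matrix (Weyl). At the origin no `C²` function touches `u` from above, since
`u` lies above every paraboloid `m|x|²/2` there. From below nothing is needed: `Du(0) = 0`, so the
right-hand side is `c = nπ/2`, which bounds every Lagrangian angle. -/

/-! ### Eigenvalue monotonicity and the Lagrangian angle -/

/-- Dimension count: the orthogonality conditions are fewer than the dimension, so they have a
nonzero common solution. -/
theorem OrthonormalBasis.exists_ne_zero_inner_eq_zero {ι E : Type*} [Fintype ι] [DecidableEq ι]
    [NormedAddCommGroup E] [InnerProductSpace ℝ E] (b b' : OrthonormalBasis ι ℝ E) (S T : Finset ι)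
    (h : Fintype.card ι < S.card + T.card) :
    ∃ v : E, v ≠ 0 ∧ (∀ j ∉ S, inner ℝ (b j) v = 0) ∧ ∀ j ∉ T, inner ℝ (b' j) v = 0 := by
  have : FiniteDimensional ℝ E := b.toBasis.finiteDimensional_of_finite
  let f : E →ₗ[ℝ] ((Sᶜ : Finset ι) → ℝ) × ((Tᶜ : Finset ι) → ℝ) :=
    (LinearMap.pi fun j : (Sᶜ : Finset ι) => innerₛₗ ℝ (b j)).prod
      (LinearMap.pi fun j : (Tᶜ : Finset ι) => innerₛₗ ℝ (b' j))
  have hf : LinearMap.ker f ≠ ⊥ := by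
    apply LinearMap.ker_ne_bot_of_finrank_lt
    rw [Module.finrank_prod, Module.finrank_fintype_fun_eq_card, Module.finrank_fintype_fun_eq_card,
      Module.finrank_eq_card_basis b.toBasis, Fintype.card_coe, Fintype.card_coe,
      Finset.card_compl, Finset.card_compl]
    have := S.card_le_univ
    have := T.card_le_univ
    omega
  obtain ⟨v, hv, hv0⟩ := Submodule.exists_mem_ne_zero_of_ne_bot hf
  have hv' : f v = 0 := hv
  refine ⟨v, hv0, fun j hj => ?_, fun j hj => ?_⟩
  · exact congrFun (congrArg Prod.fst hv') ⟨j, by simpa using hj⟩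
  · exact congrFun (congrArg Prod.snd hv') ⟨j, by simpa using hj⟩

namespace Matrix.IsHermitian

variable {ι : Type*} [Fintype ι] [DecidableEq ι] {A B : Matrix ι ι ℝ}

theorem inner_toEuclideanLin_eq_sum (hA : A.IsHermitian) (v : EuclideanSpace ℝ ι) :
    inner ℝ v (A.toEuclideanLin v) =
      ∑ j, hA.eigenvalues j * inner ℝ (hA.eigenvectorBasis j) v ^ 2 := by
  rw [← hA.eigenvectorBasis.sum_inner_mul_inner]
  refine Finset.sum_congr rfl fun j _ => ?_
  have h1 : A.toEuclideanLin (hA.eigenvectorBasis j) =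
      hA.eigenvalues j • hA.eigenvectorBasis j := by
    apply (WithLp.equiv 2 _).injective
    exact hA.mulVec_eigenvectorBasis j
  rw [← (Matrix.isSymmetric_toEuclideanLin_iff.mpr hA) _ v, h1, real_inner_smul_left,
    real_inner_comm v]
  ring

/-- **Weyl's monotonicity theorem**: the sorted eigenvalues are monotone in the matrix. -/
theorem eigenvalues_le_of_inner_le (hA : A.IsHermitian) (hB : B.IsHermitian)
    (h : ∀ v : EuclideanSpace ℝ ι,
      inner ℝ v (A.toEuclideanLin v) ≤ inner ℝ v (B.toEuclideanLin v)) (i : ι) :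
    hA.eigenvalues i ≤ hB.eigenvalues i := by
  set e := (Fintype.equivOfCardEq (Fintype.card_fin (Fintype.card ι)) :
    Fin (Fintype.card ι) ≃ ι) with he
  have eigA : ∀ j, hA.eigenvalues j = hA.eigenvalues₀ (e.symm j) := fun _ => rfl
  have eigB : ∀ j, hB.eigenvalues j = hB.eigenvalues₀ (e.symm j) := fun _ => rfl
  -- Eigenvalues are sorted decreasingly. With `k = e.symm i`, `v` lies in the span of the top `k +
  -- 1` eigenvectors of `A` and of the bottom `N - k` of `B`, where `N` is the dimension; these
  -- counts add up to `N + 1`.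
  obtain ⟨v, hv0, hvA, hvB⟩ := hA.eigenvectorBasis.exists_ne_zero_inner_eq_zero hB.eigenvectorBasis
    ((Finset.Iic (e.symm i)).map e.toEmbedding) ((Finset.Ici (e.symm i)).map e.toEmbedding) (by
      have := (e.symm i).2
      simp only [Finset.card_map, Fin.card_Iic, Fin.card_Ici]
      omega)
  have hn : 0 < ‖v‖ ^ 2 := by positivity
  have h1 : hA.eigenvalues i * ‖v‖ ^ 2 ≤ inner ℝ v (A.toEuclideanLin v) := by
    rw [hA.inner_toEuclideanLin_eq_sum, ← hA.eigenvectorBasis.sum_sq_inner_right, Finset.mul_sum]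
    refine Finset.sum_le_sum fun j _ => ?_
    by_cases hj : j ∈ (Finset.Iic (e.symm i)).map e.toEmbedding
    · refine mul_le_mul_of_nonneg_right ?_ (sq_nonneg _)
      rw [eigA, eigA]
      apply hA.eigenvalues₀_antitone
      simpa [Finset.mem_map_equiv] using hj
    · simp [hvA j hj]
  have h2 : inner ℝ v (B.toEuclideanLin v) ≤ hB.eigenvalues i * ‖v‖ ^ 2 := by
    rw [hB.inner_toEuclideanLin_eq_sum, ← hB.eigenvectorBasis.sum_sq_inner_right, Finset.mul_sum]
    refine Finset.sum_le_sum fun j _ => ?_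
    by_cases hj : j ∈ (Finset.Ici (e.symm i)).map e.toEmbedding
    · refine mul_le_mul_of_nonneg_right ?_ (sq_nonneg _)
      rw [eigB, eigB]
      apply hB.eigenvalues₀_antitone
      simpa [Finset.mem_map_equiv] using hj
    · simp [hvB j hj]
  exact le_of_mul_le_mul_right (h1.trans ((h v).trans h2)) hn

end Matrix.IsHermitian

theorem lagrangianAngle_mono {n : ℕ} {A B : Matrix (Fin n) (Fin n) ℝ} (hA : A.IsHermitian)
    (hB : B.IsHermitian) (h : ∀ v : EuclideanSpace ℝ (Fin n),
      inner ℝ v (A.toEuclideanLin v) ≤ inner ℝ v (B.toEuclideanLin v)) :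
    lagrangianAngle A ≤ lagrangianAngle B := by
  rw [lagrangianAngle_eq_sum hA, lagrangianAngle_eq_sum hB]
  exact Finset.sum_le_sum fun i _ =>
    Real.arctan_strictMono.monotone (hA.eigenvalues_le_of_inner_le hB h i)

/-- Gives the supersolution test at the origin, where the phase equals `nπ/2`. -/
theorem lagrangianAngle_le {n : ℕ} (A : Matrix (Fin n) (Fin n) ℝ) :
    lagrangianAngle A ≤ n * Real.pi / 2 := by
  have h1 : lagrangianAngle A ≤ (A.charpoly.roots.map Real.arctan).card • (Real.pi / 2) := by
    refine Multiset.sum_le_card_nsmul _ _ fun x hx => ?_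
    obtain ⟨y, -, rfl⟩ := Multiset.mem_map.1 hx
    exact (Real.arctan_lt_pi_div_two y).le
  have h2 : A.charpoly.roots.card ≤ n := by
    simpa using A.charpoly.card_roots'
  rw [Multiset.card_map, nsmul_eq_mul] at h1
  have h3 : (A.charpoly.roots.card : ℝ) ≤ n := by exact_mod_cast h2
  nlinarith [Real.pi_pos]

/-- A rank-one perturbation of a scalar matrix moves only the eigenvalue in the direction `x`.
Hessians of radial functions have this form. -/
theorem lagrangianAngle_scalar_add_vecMulVec {n : ℕ} (hn : 1 ≤ n) (α β : ℝ) (x : Fin n → ℝ) :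
    lagrangianAngle (Matrix.scalar (Fin n) α + β • Matrix.vecMulVec x x) =
      Real.arctan (α + β * (x ⬝ᵥ x)) + (n - 1) * Real.arctan α := by
  open Polynomial in
  have h : (Matrix.scalar (Fin n) α + β • Matrix.vecMulVec x x).charpoly =
      (X - C α) ^ (n - 1) * (X - C (α + β * (x ⬝ᵥ x))) := by
    have h1 := Matrix.charpoly_sub_scalar (Matrix.vecMulVec (β • x) x) (-α)
    have h2 : Matrix.vecMulVec (β • x) x - Matrix.scalar (Fin n) (-α) =
        Matrix.scalar (Fin n) α + β • Matrix.vecMulVec x x := by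
      rw [Matrix.smul_vecMulVec, map_neg, sub_neg_eq_add, add_comm]
    rw [h2, Matrix.charpoly_vecMulVec, Fintype.card_fin] at h1
    rw [h1]
    obtain ⟨m, rfl⟩ := Nat.exists_eq_add_of_le' hn
    simp [pow_succ, Polynomial.smul_eq_C_mul, sub_eq_add_neg]
    ring
  rw [lagrangianAngle, h, Polynomial.roots_mul, Polynomial.roots_pow, Polynomial.roots_X_sub_C,
    Polynomial.roots_X_sub_C]
  · simp [Multiset.map_nsmul, Multiset.sum_nsmul, Nat.cast_sub hn, add_comm]
  · exact mul_ne_zero (pow_ne_zero _ (Polynomial.X_sub_C_ne_zero _)) (Polynomial.X_sub_C_ne_zero _)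

/-! ### First and second order conditions at a contact point -/

theorem ContDiffAt.differentiableAt_fderiv {E : Type*} [NormedAddCommGroup E] [NormedSpace ℝ E]
    {f : E → ℝ} {x : E} (hf : ContDiffAt ℝ 2 f x) : DifferentiableAt ℝ (fderiv ℝ f) x :=
  (hf.fderiv_right (m := 1) (by norm_num)).differentiableAt (by norm_num)

/-- The second-order necessary condition for a local minimum on the line. -/
theorem IsLocalMin.deriv_deriv_nonneg {f : ℝ → ℝ} {x : ℝ} (h : IsLocalMin f x)
    (hc : ContinuousAt f x) : 0 ≤ deriv (deriv f) x := by
  by_contra! hneg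
  -- Being both a local minimum and a local maximum forces `f` to be locally constant, so its second
  -- derivative vanishes.
  have hmax := isLocalMax_of_deriv_deriv_neg hneg h.deriv_eq_zero hc
  have heq : f =ᶠ[𝓝 x] fun _ => f x := by
    filter_upwards [h, hmax] with y h1 h2 using le_antisymm h2 h1
  have h2 := heq.deriv.deriv_eq
  simp at h2
  exact hneg.ne h2

/-- The second-order necessary condition for a local minimum. -/
theorem IsLocalMin.fderiv_fderiv_nonneg {E : Type*} [NormedAddCommGroup E] [NormedSpace ℝ E]
    {f : E → ℝ} {x : E} (h : IsLocalMin f x) (hf : ContDiffAt ℝ 2 f x) (v : E) :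
    0 ≤ fderiv ℝ (fderiv ℝ f) x v v := by
  have hl : ∀ t : ℝ, HasDerivAt (fun t : ℝ => x + t • v) v t := fun t => by
    simpa using ((hasDerivAt_id t).smul_const v).const_add x
  have hl0 : Filter.Tendsto (fun t : ℝ => x + t • v) (𝓝 0) (𝓝 x) := by
    simpa using (hl 0).continuousAt.tendsto
  have hd : ∀ᶠ y in 𝓝 x, DifferentiableAt ℝ f y :=
    (hf.eventually (by norm_num)).mono fun y hy => hy.differentiableAt (by norm_num)
  have h1 : deriv (fun t : ℝ => f (x + t • v)) =ᶠ[𝓝 0] fun t => fderiv ℝ f (x + t • v) v := by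
    filter_upwards [hl0.eventually hd] with t ht
    exact (ht.hasFDerivAt.comp_hasDerivAt t (hl t)).deriv
  have h2 : HasDerivAt (fun t : ℝ => fderiv ℝ f (x + t • v) v) (fderiv ℝ (fderiv ℝ f) x v v) 0 := by
    have h3 : HasFDerivAt (fderiv ℝ f) (fderiv ℝ (fderiv ℝ f) x) (x + (0 : ℝ) • v) := by
      simpa using hf.differentiableAt_fderiv.hasFDerivAt
    have h4 : HasDerivAt (fun t : ℝ => fderiv ℝ f (x + t • v)) (fderiv ℝ (fderiv ℝ f) x v) 0 :=
      h3.comp_hasDerivAt (0 : ℝ) (hl 0)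
    have h5 := ((ContinuousLinearMap.apply ℝ ℝ v).hasFDerivAt (x := fderiv ℝ f (x + (0 : ℝ) • v)))
    exact h5.comp_hasDerivAt (0 : ℝ) h4
  rw [← h2.deriv, ← h1.deriv_eq]
  apply IsLocalMin.deriv_deriv_nonneg
  · have : ∀ᶠ t in 𝓝 (0 : ℝ), f x ≤ f (x + t • v) := hl0.eventually h
    simpa [IsLocalMin, IsMinFilter] using this
  · have : ContinuousAt f (x + (0 : ℝ) • v) := by simpa using hf.continuousAt
    exact ContinuousAt.comp (f := fun t : ℝ => x + t • v) this (hl 0).continuousAt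

theorem inner_toEuclideanLin_hessianMatrix {n : ℕ} (φ : EuclideanSpace ℝ (Fin n) → ℝ)
    (x v : EuclideanSpace ℝ (Fin n)) :
    inner ℝ v ((hessianMatrix φ x).toEuclideanLin v) = fderiv ℝ (fderiv ℝ φ) x v v := by
  have hv : v = ∑ i, v i • EuclideanSpace.single i (1 : ℝ) := by
    simpa using ((EuclideanSpace.basisFun (Fin n) ℝ).sum_repr v).symm
  have h1 : fderiv ℝ (fderiv ℝ φ) x v v = ∑ i, v i * ∑ j, v j * hessianMatrix φ x i j := by
    conv_lhs => rw [hv]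
    simp only [map_sum, map_smul, sum_apply, smul_apply,
      smul_eq_mul, hessianMatrix, Matrix.of_apply, Finset.mul_sum]
    rw [Finset.sum_comm]
    refine Finset.sum_congr rfl fun i _ => Finset.sum_congr rfl fun j _ => by ring
  rw [h1]
  simp [PiLp.inner_apply, Matrix.toLpLin_apply, Matrix.mulVec, dotProduct, mul_comm]

theorem isHermitian_hessianMatrix {n : ℕ} {φ : EuclideanSpace ℝ (Fin n) → ℝ}
    {x : EuclideanSpace ℝ (Fin n)} (hφ : ContDiffAt ℝ 2 φ x) : (hessianMatrix φ x).IsHermitian := by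
  ext i j
  simpa [hessianMatrix] using
    (hφ.isSymmSndFDerivAt (by simp)) (EuclideanSpace.single j 1) (EuclideanSpace.single i 1)

theorem fderiv_fderiv_le_of_eventually_le {E : Type*} [NormedAddCommGroup E] [NormedSpace ℝ E]
    {f g : E → ℝ} {x : E} (hf : ContDiffAt ℝ 2 f x) (hg : ContDiffAt ℝ 2 g x) (hx : f x = g x)
    (h : ∀ᶠ y in 𝓝 x, f y ≤ g y) (v : E) :
    fderiv ℝ (fderiv ℝ f) x v v ≤ fderiv ℝ (fderiv ℝ g) x v v := by
  have hmin : IsLocalMin (fun y => g y - f y) x := by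
    filter_upwards [h] with y hy
    simpa [hx] using hy
  have h1 := hmin.fderiv_fderiv_nonneg (hg.sub hf) v
  have hd : ∀ {k : E → ℝ}, ContDiffAt ℝ 2 k x → ∀ᶠ y in 𝓝 x, DifferentiableAt ℝ k y := fun hk =>
    (hk.eventually (by norm_num)).mono fun y hy => hy.differentiableAt (by norm_num)
  have h2 : fderiv ℝ (fun y => g y - f y) =ᶠ[𝓝 x] fun y => fderiv ℝ g y - fderiv ℝ f y := by
    filter_upwards [hd hf, hd hg] with y h1 h2 using fderiv_fun_sub h2 h1
  rw [h2.fderiv_eq, fderiv_fun_sub hg.differentiableAt_fderiv hf.differentiableAt_fderiv] at h1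
  simpa using h1

theorem fderiv_eq_of_eventually_le {E : Type*} [NormedAddCommGroup E] [NormedSpace ℝ E]
    {f g : E → ℝ} {x : E} (hf : DifferentiableAt ℝ f x) (hg : DifferentiableAt ℝ g x)
    (hx : f x = g x) (h : ∀ᶠ y in 𝓝 x, f y ≤ g y) : fderiv ℝ f x = fderiv ℝ g x := by
  have hmin : IsLocalMin (fun y => g y - f y) x := by
    filter_upwards [h] with y hy
    simpa [hx] using hy
  have h1 := hmin.fderiv_eq_zero
  rw [fderiv_fun_sub hg hf, sub_eq_zero] at h1
  exact h1.symm

/-- Degenerate ellipticity: this is what makes a classical solution a viscosity solution. -/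
theorem lagrangianAngle_hessianMatrix_le {n : ℕ} {f g : EuclideanSpace ℝ (Fin n) → ℝ}
    {x : EuclideanSpace ℝ (Fin n)} (hf : ContDiffAt ℝ 2 f x) (hg : ContDiffAt ℝ 2 g x)
    (hx : f x = g x) (h : ∀ᶠ y in 𝓝 x, f y ≤ g y) :
    lagrangianAngle (hessianMatrix f x) ≤ lagrangianAngle (hessianMatrix g x) :=
  lagrangianAngle_mono (isHermitian_hessianMatrix hf) (isHermitian_hessianMatrix hg) fun v => by
    simpa only [inner_toEuclideanLin_hessianMatrix] using
      fderiv_fderiv_le_of_eventually_le hf hg hx h v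

/-! ### The singular ODE as a fixed point problem -/

theorem integral_pow_pred_mul_le {n : ℕ} (hn : 1 ≤ n) {f : ℝ → ℝ} {D : ℝ}
    (hf : ∀ t ∈ Set.Ioc (0 : ℝ) 1, |f t| ≤ D) : |∫ t in (0 : ℝ)..1, t ^ (n - 1) * f t| ≤ D / n := by
  have h1 : ∫ t in (0 : ℝ)..1, t ^ (n - 1) * D = D / n := by
    rw [intervalIntegral.integral_mul_const, integral_pow]
    simp [Nat.cast_sub hn]
    ring
  rw [← h1, ← Real.norm_eq_abs]
  apply intervalIntegral.norm_integral_le_of_norm_le zero_le_one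
  · refine Filter.Eventually.of_forall fun t ht => ?_
    rw [norm_mul, norm_pow, Real.norm_of_nonneg ht.1.le]
    exact mul_le_mul_of_nonneg_left (hf t ht) (pow_nonneg ht.1.le _)
  · exact (by fun_prop : Continuous fun t : ℝ => t ^ (n - 1) * D).intervalIntegrable _ _

/-- The integral operator whose fixed points solve the singular equation
`R φ' + n φ = β R² + q (β R² - n φ)` on `[0, 1]`. -/
noncomputable def singularPicard (n : ℕ) (β : ℝ) {q : ℝ → ℝ} (hq : Continuous q)
    (φ : C(Set.Icc (0 : ℝ) 1, ℝ)) : C(Set.Icc (0 : ℝ) 1, ℝ) where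
  toFun R := ∫ t in (0 : ℝ)..1, t ^ (n - 1) * (β * (t * R) ^ 2 +
    q (β * (t * R) ^ 2 - n * φ (Set.projIcc 0 1 zero_le_one (t * R))))
  continuous_toFun := by
    apply intervalIntegral.continuous_parametric_intervalIntegral_of_continuous'
    have := continuous_projIcc (a := (0 : ℝ)) (b := 1) (h := zero_le_one)
    fun_prop

/-- The weight `t^(n-1)` has mass `1/n`, which cancels the factor `n` in front of `φ` inside `q`;
the Lipschitz constant of `q` is left. -/
theorem singularPicard_contracting {n : ℕ} (hn : 1 ≤ n) (β : ℝ) {q : ℝ → ℝ} {ε : ℝ≥0}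
    (hε : ε < 1) (hq : LipschitzWith ε q) :
    ContractingWith ε (singularPicard n β hq.continuous) := by
  refine ⟨hε, LipschitzWith.of_dist_le_mul fun φ ψ => ?_⟩
  rw [ContinuousMap.dist_le (by positivity)]
  intro R
  have hi : ∀ χ : C(Set.Icc (0 : ℝ) 1, ℝ), IntervalIntegrable (fun t : ℝ => t ^ (n - 1) *
      (β * (t * R) ^ 2 + q (β * (t * R) ^ 2 - n * χ (Set.projIcc 0 1 zero_le_one (t * R)))))
      MeasureTheory.volume 0 1 := fun χ => by
    apply Continuous.intervalIntegrable
    have := continuous_projIcc (a := (0 : ℝ)) (b := 1) (h := zero_le_one)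
    have := hq.continuous
    fun_prop
  have hn' : (0 : ℝ) < n := by exact_mod_cast hn
  simp only [singularPicard, ContinuousMap.coe_mk, Real.dist_eq]
  rw [← intervalIntegral.integral_sub (hi φ) (hi ψ)]
  simp_rw [← mul_sub, add_sub_add_left_eq_sub]
  refine (integral_pow_pred_mul_le hn (D := ε * (n * dist φ ψ)) fun t _ => ?_).trans_eq
    (by field_simp)
  have h1 := hq.dist_le_mul (β * (t * R) ^ 2 - n * φ (Set.projIcc 0 1 zero_le_one (t * R)))
    (β * (t * R) ^ 2 - n * ψ (Set.projIcc 0 1 zero_le_one (t * R)))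
  rw [dist_sub_left, Real.dist_eq, Real.dist_eq, ← mul_sub, abs_mul, Nat.abs_cast] at h1
  refine h1.trans ?_
  gcongr
  exact ContinuousMap.dist_apply_le_dist (f := φ) (g := ψ) _

/-- A solution in integrated form of the singular initial value problem
`R φ' + n φ = β R² + q (β R² - n φ)`, `φ(0) = 0`. -/
theorem exists_singular_fixedPoint {n : ℕ} (hn : 1 ≤ n) {β : ℝ} (hβ : 0 ≤ β) {q : ℝ → ℝ} {ε : ℝ≥0}
    (hε : ε ≤ 1 / 3) (hq : LipschitzWith ε q) (hq0 : q 0 = 0) :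
    ∃ φ : ℝ → ℝ, Continuous φ ∧ (∀ R ∈ Set.Icc (0 : ℝ) 1, |φ R| ≤ 2 * β / n * R ^ 2) ∧
      ∀ R ∈ Set.Icc (0 : ℝ) 1, φ R = ∫ t in (0 : ℝ)..1,
        t ^ (n - 1) * (β * (t * R) ^ 2 + q (β * (t * R) ^ 2 - n * φ (t * R))) := by
  have hn' : (0 : ℝ) < n := by exact_mod_cast hn
  have hε' : (ε : ℝ) ≤ 1 / 3 := by exact_mod_cast hε
  have hq1 : ∀ y, |q y| ≤ ε * |y| := fun y => by
    simpa [hq0] using hq.dist_le_mul y 0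
  have hc := singularPicard_contracting hn β (hε.trans_lt (by
    rw [← NNReal.coe_lt_coe]; norm_num)) hq
  set Φ := singularPicard n β hq.continuous with hΦ
  -- An invariant closed set containing 0: on it the argument of `q` is at most `3βR²`, so with `ε ≤
  -- 1/3` the integrand without its weight is at most `2βR²`, and the mass `1/n` restores the bound.
  let P : Set C(Set.Icc (0 : ℝ) 1, ℝ) := {φ | ∀ R, |φ R| ≤ 2 * β / n * (R : ℝ) ^ 2}
  have hPc : IsClosed P := by
    simp only [P, Set.ofPred_forall]
    refine isClosed_iInter fun R => isClosed_le ?_ continuous_const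
    fun_prop
  have hPΦ : Set.MapsTo Φ P P := by
    intro φ hφ R
    have hR := R.2
    simp only [hΦ, singularPicard, ContinuousMap.coe_mk]
    refine (integral_pow_pred_mul_le hn (D := 2 * β * (R : ℝ) ^ 2) fun t ht => ?_).trans_eq
      (by ring)
    have htR : t * (R : ℝ) ∈ Set.Icc (0 : ℝ) 1 :=
      ⟨mul_nonneg ht.1.le hR.1, mul_le_one₀ ht.2 hR.1 hR.2⟩
    have htR2 : (t * R) ^ 2 ≤ (R : ℝ) ^ 2 :=
      pow_le_pow_left₀ htR.1 (mul_le_of_le_one_left hR.1 ht.2) 2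
    have h1 := hφ (Set.projIcc 0 1 zero_le_one (t * R))
    rw [Set.projIcc_of_mem zero_le_one htR] at h1 ⊢
    dsimp only at h1
    have h2 : |β * (t * R) ^ 2 - n * φ ⟨t * R, htR⟩| ≤ 3 * β * (t * R) ^ 2 := by
      refine (abs_sub _ _).trans ?_
      rw [abs_of_nonneg (by positivity : 0 ≤ β * (t * (R : ℝ)) ^ 2), abs_mul, Nat.abs_cast]
      have : n * |φ ⟨t * R, htR⟩| ≤ n * (2 * β / n * (t * R) ^ 2) := by gcongr
      have h3 : n * (2 * β / n * (t * (R : ℝ)) ^ 2) = 2 * β * (t * R) ^ 2 := by field_simp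
      linarith
    have h3 := hq1 (β * (t * R) ^ 2 - n * φ ⟨t * R, htR⟩)
    have h4 : |q (β * (t * R) ^ 2 - n * φ ⟨t * R, htR⟩)| ≤ 1 / 3 * (3 * β * (t * R) ^ 2) :=
      h3.trans (mul_le_mul hε' h2 (abs_nonneg _) (by norm_num))
    refine (abs_add_le _ _).trans ?_
    rw [abs_of_nonneg (by positivity : 0 ≤ β * (t * (R : ℝ)) ^ 2)]
    have := mul_le_mul_of_nonneg_left htR2 hβ
    linarith
  have hP : ContractingWith.fixedPoint Φ hc ∈ P := by
    refine hPc.mem_of_tendsto (hc.tendsto_iterate_fixedPoint 0)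
      (Filter.Eventually.of_forall fun k => hPΦ.iterate k ?_)
    intro R
    simp only [ContinuousMap.zero_apply, abs_zero]
    positivity
  set φ := ContractingWith.fixedPoint Φ hc with hφ
  refine ⟨fun R => φ (Set.projIcc 0 1 zero_le_one R), φ.continuous.comp continuous_projIcc,
    fun R hR => ?_, fun R hR => ?_⟩
  · have := hP (Set.projIcc 0 1 zero_le_one R)
    simp only [Set.projIcc_of_mem zero_le_one hR] at this ⊢
    exact this
  · have := congrArg (fun ψ : C(Set.Icc (0 : ℝ) 1, ℝ) => ψ ⟨R, hR⟩) hc.fixedPoint_isFixedPt.eq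
    simp only [Set.projIcc_of_mem zero_le_one hR]
    exact this.symm

/-- `φ` differs from the linear solution `βR²/(n+2)` by a relative error of at most `3ε`, and `6nε ≤
1` makes both `3ε` and `3nε` at most `1/2`. The upper bound keeps `βR² - nφ` positive, since its
coefficient is below 1. -/
theorem singular_bounds {n : ℕ} (hn : 1 ≤ n) {β : ℝ} (hβ : 0 < β) {q : ℝ → ℝ} {ε : ℝ≥0}
    (hε : 6 * n * (ε : ℝ) ≤ 1) (hq : LipschitzWith ε q) (hq0 : q 0 = 0) {φ : ℝ → ℝ}
    (hφc : Continuous φ) (hφ : ∀ R ∈ Set.Icc (0 : ℝ) 1, |φ R| ≤ 2 * β / n * R ^ 2)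
    (hint : ∀ R ∈ Set.Icc (0 : ℝ) 1, φ R = ∫ t in (0 : ℝ)..1,
        t ^ (n - 1) * (β * (t * R) ^ 2 + q (β * (t * R) ^ 2 - n * φ (t * R))))
    {R : ℝ} (hR : R ∈ Set.Icc (0 : ℝ) 1) :
    β / (2 * (n + 2)) * R ^ 2 ≤ φ R ∧ n * φ R ≤ (n + 1 / 2) / (n + 2) * (β * R ^ 2) := by
  have hn' : (1 : ℝ) ≤ n := by exact_mod_cast hn
  have hint' : ∫ t in (0 : ℝ)..1, t ^ (n - 1) * (t * R) ^ 2 = R ^ 2 / (n + 2) := by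
    have : ∀ t : ℝ, t ^ (n - 1) * (t * R) ^ 2 = t ^ (n + 1) * R ^ 2 := fun t => by
      obtain ⟨m, rfl⟩ := Nat.exists_eq_add_of_le' hn
      simp only [Nat.add_sub_cancel]
      ring
    simp_rw [this]
    rw [intervalIntegral.integral_mul_const, integral_pow]
    simp
    ring
  have hq1 : ∀ y, |q y| ≤ ε * |y| := fun y => by
    simpa [hq0] using hq.dist_le_mul y 0
  have hb : |φ R - β * (R ^ 2 / (n + 2))| ≤ 3 * ε * β * (R ^ 2 / (n + 2)) := by
    have hqc := hq.continuous
    rw [← hint', ← intervalIntegral.integral_const_mul, ← intervalIntegral.integral_const_mul,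
      hint R hR, ← intervalIntegral.integral_sub, ← Real.norm_eq_abs]
    · apply intervalIntegral.norm_integral_le_of_norm_le zero_le_one
      · refine Filter.Eventually.of_forall fun t ht => ?_
        have htR : t * R ∈ Set.Icc (0 : ℝ) 1 :=
          ⟨mul_nonneg ht.1.le hR.1, mul_le_one₀ ht.2 hR.1 hR.2⟩
        have h1 := hφ _ htR
        have h2 : |β * (t * R) ^ 2 - n * φ (t * R)| ≤ 3 * β * (t * R) ^ 2 := by
          refine (abs_sub _ _).trans ?_
          rw [abs_of_nonneg (by positivity : 0 ≤ β * (t * (R : ℝ)) ^ 2), abs_mul, Nat.abs_cast]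
          have : n * |φ (t * R)| ≤ n * (2 * β / n * (t * R) ^ 2) := by gcongr
          have h3 : n * (2 * β / n * (t * (R : ℝ)) ^ 2) = 2 * β * (t * R) ^ 2 := by field_simp
          linarith
        have h3 : |q (β * (t * R) ^ 2 - n * φ (t * R))| ≤ ε * (3 * β * (t * R) ^ 2) :=
          (hq1 _).trans (by gcongr)
        have h4 : t ^ (n - 1) * (β * (t * R) ^ 2 + q (β * (t * R) ^ 2 - n * φ (t * R))) -
            β * (t ^ (n - 1) * (t * R) ^ 2) =
            t ^ (n - 1) * q (β * (t * R) ^ 2 - n * φ (t * R)) := by ring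
        rw [h4, norm_mul, norm_pow, Real.norm_of_nonneg ht.1.le, Real.norm_eq_abs]
        have := mul_le_mul_of_nonneg_left h3 (pow_nonneg ht.1.le (n - 1))
        linarith
      · exact Continuous.intervalIntegrable (by fun_prop) _ _
    · exact Continuous.intervalIntegrable (by fun_prop) _ _
    · exact Continuous.intervalIntegrable (by fun_prop) _ _
  obtain ⟨hb1, hb2⟩ := abs_le.1 hb
  have hX : 0 ≤ β * (R ^ 2 / (n + 2)) := by positivity
  have hε1 : (ε : ℝ) ≤ 1 / 6 := by nlinarith [ε.2]
  constructor
  · have : β / (2 * (n + 2)) * R ^ 2 = β * (R ^ 2 / (n + 2)) / 2 := by field_simp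
    rw [this]
    nlinarith
  · have : (n + 1 / 2) / (n + 2) * (β * R ^ 2) = (n + 1 / 2) * (β * (R ^ 2 / (n + 2))) := by
      field_simp
    rw [this]
    have h5 : n * φ R ≤ n * (β * (R ^ 2 / (n + 2)) + 3 * ε * β * (R ^ 2 / (n + 2))) := by
      gcongr; linarith
    nlinarith

/-- Substituting `s = tR` gives `R^n φ(R) = ∫₀ᴿ s^(n-1) G(s) ds`, which is differentiable by the
fundamental theorem of calculus. -/
theorem singular_hasDerivAt {n : ℕ} (hn : 1 ≤ n) {φ G : ℝ → ℝ} (hG : Continuous G)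
    (hint : ∀ R ∈ Set.Icc (0 : ℝ) 1, φ R = ∫ t in (0 : ℝ)..1, t ^ (n - 1) * G (t * R))
    {R : ℝ} (hR : R ∈ Set.Ioo (0 : ℝ) 1) : HasDerivAt φ ((G R - n * φ R) / R) R := by
  have hc : Continuous fun s : ℝ => s ^ (n - 1) * G s := by fun_prop
  have h1 : ∀ S ∈ Set.Ioo (0 : ℝ) 1, φ S = (∫ s in (0 : ℝ)..S, s ^ (n - 1) * G s) / S ^ n := by
    intro S hS
    have hS0 : S ≠ 0 := hS.1.ne'
    have h2 : (∫ s in (0 : ℝ)..S, s ^ (n - 1) * G s) =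
        S * ∫ t in (0 : ℝ)..1, (t * S) ^ (n - 1) * G (t * S) := by
      have := intervalIntegral.integral_comp_mul_right (a := 0) (b := 1)
        (fun s : ℝ => s ^ (n - 1) * G s) hS0
      rw [this]
      simp [hS0]
    rw [hint S ⟨hS.1.le, hS.2.le⟩, h2, eq_div_iff (pow_ne_zero _ hS0)]
    simp_rw [mul_pow, mul_right_comm _ (S ^ (n - 1))]
    rw [intervalIntegral.integral_mul_const]
    obtain ⟨m, rfl⟩ := Nat.exists_eq_add_of_le' hn
    simp only [Nat.add_sub_cancel, pow_succ]
    ring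
  have h3 : φ =ᶠ[𝓝 R] fun S => (∫ s in (0 : ℝ)..S, s ^ (n - 1) * G s) / S ^ n := by
    filter_upwards [isOpen_Ioo.mem_nhds hR] with S hS using h1 S hS
  have hR0 : R ≠ 0 := hR.1.ne'
  have h4 : HasDerivAt (fun S => ∫ s in (0 : ℝ)..S, s ^ (n - 1) * G s) (R ^ (n - 1) * G R) R :=
    intervalIntegral.integral_hasDerivAt_right (hc.intervalIntegrable _ _)
      (hc.stronglyMeasurableAtFilter _ _) hc.continuousAt
  have h5 := (h4.div (hasDerivAt_pow n R) (pow_ne_zero _ hR0)).congr_of_eventuallyEq h3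
  refine h5.congr_deriv ?_
  rw [h1 R hR]
  obtain ⟨m, rfl⟩ := Nat.exists_eq_add_of_le' hn
  simp only [Nat.add_sub_cancel, pow_succ]
  field_simp

/-- The derivative `1/cos² - 1` of `tan y - y` vanishes at 0, so the Lipschitz constant is as small
as desired near 0. Extending to the whole line lets the integral operator act on all continuous
functions. -/
theorem exists_lipschitz_tan_sub_id {ε : ℝ≥0} (hε : 0 < ε) :
    ∃ η : ℝ, 0 < η ∧ ∃ q : ℝ → ℝ, LipschitzWith ε q ∧ q 0 = 0 ∧
      ∀ y, |y| < η → Real.cos y ≠ 0 ∧ q y = Real.tan y - y := by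
  have h0 : ∀ᶠ y in 𝓝 (0 : ℝ), Real.cos y ≠ 0 ∧ 1 / Real.cos y ^ 2 - 1 < ε ∧
      -(ε : ℝ) < 1 / Real.cos y ^ 2 - 1 := by
    have hc : ContinuousAt (fun y : ℝ => 1 / Real.cos y ^ 2 - 1) 0 := by
      have : Real.cos 0 ^ 2 ≠ 0 := by simp
      fun_prop (disch := assumption)
    have h1 : Real.cos 0 ≠ 0 := by simp
    refine (Real.continuous_cos.continuousAt.eventually_ne h1).and
      ((hc.eventually (gt_mem_nhds ?_)).and (hc.eventually (lt_mem_nhds ?_))) <;> simpa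
  obtain ⟨η, hη, hball⟩ := Metric.eventually_nhds_iff_ball.1 h0
  have hd : ∀ y ∈ Metric.ball (0 : ℝ) η,
      HasDerivAt (fun y => Real.tan y - y) (1 / Real.cos y ^ 2 - 1) y := fun y hy =>
    (Real.hasDerivAt_tan (hball y hy).1).sub (hasDerivAt_id y)
  have hl : LipschitzOnWith ε (fun y => Real.tan y - y) (Metric.ball 0 η) := by
    apply (convex_ball (0 : ℝ) η).lipschitzOnWith_of_nnnorm_hasDerivWithin_le
      (f' := fun y => 1 / Real.cos y ^ 2 - 1) (fun y hy => (hd y hy).hasDerivWithinAt)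
    intro y hy
    rw [← NNReal.coe_le_coe, coe_nnnorm, Real.norm_eq_abs]
    exact abs_le.2 ⟨(hball y hy).2.2.le, (hball y hy).2.1.le⟩
  obtain ⟨q, hq, heq⟩ := hl.extend_real
  refine ⟨η, hη, q, hq, ?_, fun y hy => ?_⟩
  · rw [← heq (Metric.mem_ball_self hη)]; simp
  · have hy' : y ∈ Metric.ball (0 : ℝ) η := by simpa using hy
    exact ⟨(hball y hy').1, (heq hy').symm⟩

/-- Bootstrap for an ODE: `F` is typically a smooth expression in `f`, so each order of regularity
of `f` yields the next. -/
theorem contDiffOn_infty_of_hasDerivAt {f F : ℝ → ℝ} {s : Set ℝ} (hs : IsOpen s)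
    (hf : ∀ x ∈ s, HasDerivAt f (F x) x)
    (h : ∀ k : ℕ, ContDiffOn ℝ k f s → ContDiffOn ℝ k F s) : ContDiffOn ℝ ∞ f s := by
  rw [contDiffOn_infty]
  intro k
  induction k with
  | zero =>
    exact contDiffOn_zero.2 fun x hx => (hf x hx).continuousAt.continuousWithinAt
  | succ k ih =>
    rw [Nat.cast_succ, contDiffOn_succ_iff_deriv_of_isOpen hs]
    refine ⟨fun x hx => (hf x hx).differentiableAt.differentiableWithinAt, by simp, ?_⟩
    exact (h k ih).congr fun x hx => (hf x hx).deriv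

/-! ### The profile curve, from polar form to graph -/

/-- The polar angle of the profile curve of a rotationally symmetric solution. -/
theorem exists_polarAngle {n : ℕ} (hn : 1 ≤ n) {β : ℝ} (hβ : 0 < β) :
    ∃ δ : ℝ, 0 < δ ∧ ∃ c : ℝ, 0 < c ∧ ∃ φ : ℝ → ℝ, Continuous φ ∧ φ 0 = 0 ∧
      (∀ R ∈ Set.Ioc 0 δ, c * R ^ 2 ≤ φ R ∧ 0 < φ R ∧ 0 < β * R ^ 2 - n * φ R ∧
        φ R + (β * R ^ 2 - n * φ R) ≤ 1) ∧
      (∀ R ∈ Set.Ioo 0 δ, HasDerivAt φ (Real.tan (β * R ^ 2 - n * φ R) / R) R) ∧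
      ContDiffOn ℝ ∞ φ (Set.Ioo 0 δ) := by
  have hn' : (1 : ℝ) ≤ n := by exact_mod_cast hn
  obtain ⟨ε, hε0, hε1, hε2⟩ : ∃ ε : ℝ≥0, 0 < ε ∧ ε ≤ 1 / 3 ∧ 6 * n * (ε : ℝ) ≤ 1 := by
    refine ⟨Real.toNNReal (1 / (6 * n)), by simp; omega, ?_, ?_⟩
    · rw [Real.toNNReal_le_iff_le_coe]
      simp only [one_div, NNReal.coe_inv, NNReal.coe_ofNat]
      apply inv_anti₀ <;> linarith
    · rw [Real.coe_toNNReal _ (by positivity)]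
      field_simp
      rfl
  obtain ⟨η, hη, q, hq, hq0, hqtan⟩ := exists_lipschitz_tan_sub_id hε0
  obtain ⟨φ, hφc, hφ, hint⟩ := exists_singular_fixedPoint hn hβ.le hε1 hq hq0
  have hbd := fun R (hR : R ∈ Set.Icc (0 : ℝ) 1) => singular_bounds hn hβ hε2 hq hq0 hφc hφ hint hR
  have hqc := hq.continuous
  have hder := fun R (hR : R ∈ Set.Ioo (0 : ℝ) 1) => singular_hasDerivAt hn (φ := φ)
    (G := fun s => β * s ^ 2 + q (β * s ^ 2 - n * φ s)) (by fun_prop) hint hR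
  -- `βδ² < η` keeps the argument where `q y = tan y - y`; the last condition keeps all angles below
  -- 1, hence below `π/2`.
  obtain ⟨δ, hδ0, hδ1, hδη, hδs⟩ : ∃ δ : ℝ, 0 < δ ∧ δ < 1 ∧ β * δ ^ 2 < η ∧ 3 * β * δ ^ 2 < 1 := by
    have h1 : ∀ᶠ δ in 𝓝 (0 : ℝ), δ < 1 ∧ β * δ ^ 2 < η ∧ 3 * β * δ ^ 2 < 1 := by
      refine (gt_mem_nhds one_pos).and (Filter.Eventually.and ?_ ?_)
      · exact ((by fun_prop : Continuous fun δ : ℝ => β * δ ^ 2).tendsto 0).eventually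
          (gt_mem_nhds (by simpa))
      · exact ((by fun_prop : Continuous fun δ : ℝ => 3 * β * δ ^ 2).tendsto 0).eventually
          (gt_mem_nhds (by simp))
    have h2 : ∃ᶠ δ in 𝓝 (0 : ℝ), 0 < δ := by
      exact Filter.Eventually.frequently (f := 𝓝[>] (0 : ℝ)) self_mem_nhdsWithin |>.filter_mono
        nhdsWithin_le_nhds
    obtain ⟨δ, h3, h4⟩ := (h2.and_eventually h1).exists
    exact ⟨δ, h3, h4⟩
  have hsq : ∀ R ∈ Set.Ioc (0 : ℝ) δ, 0 < β * R ^ 2 ∧ β * R ^ 2 ≤ β * δ ^ 2 := fun R hR => by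
    have h1 := pow_le_pow_left₀ hR.1.le hR.2 2
    have h2 := hR.1
    exact ⟨by positivity, by gcongr⟩
  have hpos : ∀ R ∈ Set.Ioc (0 : ℝ) δ, 0 < φ R ∧ 0 < β * R ^ 2 - n * φ R := by
    intro R hR
    have h2 := hR.1
    obtain ⟨h3, h4⟩ := hbd R ⟨hR.1.le, hR.2.trans hδ1.le⟩
    have h5 : 0 < β / (2 * (n + 2)) * R ^ 2 := by positivity
    have h6 : ((n : ℝ) + 1 / 2) / (n + 2) < 1 := by
      rw [div_lt_one (by positivity)]; linarith
    have := (hsq R hR).1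
    exact ⟨h5.trans_le h3, by nlinarith⟩
  have hder' : ∀ R ∈ Set.Ioo 0 δ, Real.cos (β * R ^ 2 - n * φ R) ≠ 0 ∧
      HasDerivAt φ (Real.tan (β * R ^ 2 - n * φ R) / R) R := by
    intro R hR
    have hR' : R ∈ Set.Ioc 0 δ := ⟨hR.1, hR.2.le⟩
    obtain ⟨h1, h2⟩ := hpos R hR'
    obtain ⟨h3, h4⟩ := hsq R hR'
    have h5 : |β * R ^ 2 - n * φ R| < η := by
      rw [abs_of_pos h2]
      nlinarith
    refine ⟨(hqtan _ h5).1, (hder R ⟨hR.1, hR.2.trans hδ1⟩).congr_deriv ?_⟩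
    rw [(hqtan _ h5).2]
    ring
  refine ⟨δ, hδ0, β / (2 * (n + 2)), by positivity, φ, hφc, ?_, ?_, fun R hR => (hder' R hR).2, ?_⟩
  · simpa using hφ 0 ⟨le_rfl, zero_le_one⟩
  · intro R hR
    obtain ⟨h1, h2⟩ := hpos R hR
    obtain ⟨h3, h4⟩ := hsq R hR
    refine ⟨(hbd R ⟨hR.1.le, hR.2.trans hδ1.le⟩).1, h1, h2, ?_⟩
    nlinarith
  · refine contDiffOn_infty_of_hasDerivAt isOpen_Ioo (fun R hR => (hder' R hR).2) fun k hk => ?_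
    refine ContDiffOn.div ?_ contDiffOn_id fun R hR => hR.1.ne'
    intro R hR
    refine ContDiffAt.comp_contDiffWithinAt (g := Real.tan) R
      (Real.contDiffAt_tan.2 (hder' R hR).1) ?_
    exact (((contDiff_const.mul (contDiff_id.pow 2)).contDiffOn).sub (contDiffOn_const.mul hk)) R hR

/-- Continuing `f` with slope 1 outside `[0, δ]` gives an increasing bijection `g` of the line,
whose order inverse is automatically continuous. Here `e` is the clamp to `[0, δ]`. -/
theorem StrictMonoOn.exists_continuous_rightInverse {f : ℝ → ℝ} {δ : ℝ} (hδ : 0 < δ)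
    (hc : Continuous f) (hf : StrictMonoOn f (Set.Icc 0 δ)) (h0 : f 0 = 0) :
    ∃ J : ℝ → ℝ, Continuous J ∧ StrictMono J ∧ J 0 = 0 ∧
      ∀ s ∈ Set.Ioo 0 (f δ), J s ∈ Set.Ioo 0 δ ∧ f (J s) = s := by
  let e : ℝ → ℝ := fun R => max 0 (min δ R)
  have heI : ∀ R, e R ∈ Set.Icc 0 δ := fun R => ⟨le_max_left _ _, max_le hδ.le (min_le_left _ _)⟩
  have he : ∀ R ∈ Set.Icc 0 δ, e R = R := fun R hR => by simp [e, hR.1, hR.2]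
  have hmono : Monotone e := fun R S h => max_le_max le_rfl (min_le_min le_rfl h)
  have hsub : ∀ R S, R ≤ S → R - e R ≤ S - e S := fun R S h => by
    simp only [e]
    rcases max_cases 0 (min δ R) with h1 | h1 <;> rcases max_cases 0 (min δ S) with h2 | h2 <;>
    rcases min_cases δ R with h3 | h3 <;> rcases min_cases δ S with h4 | h4 <;> linarith
  let g : ℝ → ℝ := fun R => f (e R) + (R - e R)
  have hec : Continuous e := by fun_prop
  have hgc : Continuous g := by fun_prop
  have hgm : StrictMono g := by
    intro R S h
    rcases (hmono h.le).lt_or_eq with h1 | h1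
    · exact add_lt_add_of_lt_of_le (hf (heI R) (heI S) h1) (hsub R S h.le)
    · simp only [g, h1]
      linarith
  have hb : ∀ R, 0 ≤ f (e R) ∧ f (e R) ≤ f δ := fun R =>
    ⟨h0 ▸ hf.monotoneOn ⟨le_rfl, hδ.le⟩ (heI R) (heI R).1,
      hf.monotoneOn (heI R) ⟨hδ.le, le_rfl⟩ (heI R).2⟩
  have hgs : Function.Surjective g := by
    apply hgc.surjective
    · refine Filter.tendsto_atTop_mono (f := fun R => R - δ) (fun R => ?_)
        (Filter.tendsto_atTop_add_const_right _ _ Filter.tendsto_id)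
      have := (hb R).1
      have := (heI R).2
      simp only [g]
      linarith
    · have hle : ∀ R, g R ≤ R + f δ := fun R => by
        have := (hb R).2
        have := (heI R).1
        simp only [g]
        linarith
      exact Filter.tendsto_atBot_mono hle
        (Filter.tendsto_atBot_add_const_right _ _ Filter.tendsto_id)
  let o := hgm.orderIsoOfSurjective g hgs
  have hgf : ∀ R ∈ Set.Icc 0 δ, g R = f R := fun R hR => by simp [g, he R hR]
  have ho : ∀ R, o.symm (g R) = R := fun R => o.symm_apply_apply R
  have ho' : ∀ s, g (o.symm s) = s := fun s => o.apply_symm_apply s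
  have ho0 : o.symm 0 = 0 := by
    have := ho 0
    rwa [hgf 0 ⟨le_rfl, hδ.le⟩, h0] at this
  have hoδ : o.symm (f δ) = δ := by
    have := ho δ
    rwa [hgf δ ⟨hδ.le, le_rfl⟩] at this
  refine ⟨o.symm, o.symm.continuous, o.symm.strictMono, ho0, fun s hs => ?_⟩
  have h1 : o.symm s ∈ Set.Ioo 0 δ :=
    ⟨by simpa only [ho0] using o.symm.strictMono hs.1,
      by simpa only [hoδ] using o.symm.strictMono hs.2⟩
  refine ⟨h1, ?_⟩
  rw [← hgf _ ⟨h1.1.le, h1.2.le⟩, ho']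

/-- The derivative of the potential of a rotationally symmetric solution. -/
theorem exists_profile {n : ℕ} (hn : 1 ≤ n) {β : ℝ} (hβ : 0 < β) :
    ∃ r : ℝ, 0 < r ∧ ∃ h : ℝ → ℝ, Continuous h ∧ h 0 = 0 ∧ ContDiffOn ℝ ∞ h (Set.Ioo 0 r) ∧
      (∀ s ∈ Set.Ioo 0 r, 0 < h s ∧ 0 < deriv h s ∧
        Real.arctan (deriv h s) + (n - 1) * Real.arctan (h s / s) =
          n * Real.pi / 2 - β * (s ^ 2 + h s ^ 2)) ∧
      AntitoneOn (fun s => h s / s) (Set.Ioo 0 r) ∧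
      (∃ C : ℝ, 0 ≤ C ∧ ∀ s ∈ Set.Ioo 0 r, h s ≤ C * s ^ (1 / 3 : ℝ)) ∧
      Filter.Tendsto (fun s => h s / s) (𝓝[>] 0) Filter.atTop := by
  obtain ⟨δ, hδ, c, hc, φ, hφc, hφ0, hφ, hφd, hφs⟩ := exists_polarAngle hn hβ
  have hpi := Real.pi_gt_three
  let y : ℝ → ℝ := fun R => β * R ^ 2 - n * φ R
  have hy : ∀ R, y R = β * R ^ 2 - n * φ R := fun _ => rfl
  replace hφd : ∀ R ∈ Set.Ioo 0 δ, HasDerivAt φ (Real.tan (y R) / R) R := hφd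
  -- The abscissa `s` of the curve; its inverse `J` recovers `R` from `s`. The angle `y` lies
  -- between position vector and tangent, so the tangent makes the angle `φ + y` with the vertical.
  let f : ℝ → ℝ := fun R => R * Real.sin (φ R)
  have hIoc : ∀ {R}, R ∈ Set.Ioo 0 δ → R ∈ Set.Ioc 0 δ := fun hR => ⟨hR.1, hR.2.le⟩
  have hfd : ∀ R ∈ Set.Ioo 0 δ, HasDerivAt f
      (Real.sin (φ R) + Real.cos (φ R) * Real.tan (y R)) R := fun R hR => by
    refine ((hasDerivAt_id R).mul (hφd R hR).sin).congr_deriv ?_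
    have := hR.1.ne'
    simp only [id]
    field_simp
  have hpos : ∀ R ∈ Set.Ioo 0 δ, 0 < Real.sin (φ R) ∧ 0 < Real.cos (φ R) ∧
      0 < Real.cos (y R) ∧ 0 < Real.tan (y R) := by
    intro R hR
    obtain ⟨-, h1, h2, h3⟩ := hφ R (hIoc hR)
    have h4 := hy R
    refine ⟨Real.sin_pos_of_pos_of_lt_pi h1 ?_, Real.cos_pos_of_mem_Ioo ⟨?_, ?_⟩,
      Real.cos_pos_of_mem_Ioo ⟨?_, ?_⟩, Real.tan_pos_of_pos_of_lt_pi_div_two h2 ?_⟩ <;> linarith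
  have hfpos : ∀ R ∈ Set.Ioo 0 δ, 0 < Real.sin (φ R) + Real.cos (φ R) * Real.tan (y R) :=
    fun R hR => by
      obtain ⟨h1, h2, h3, h4⟩ := hpos R hR
      positivity
  have hfm : StrictMonoOn f (Set.Icc 0 δ) := by
    apply strictMonoOn_of_deriv_pos (convex_Icc 0 δ) (by fun_prop)
    intro R hR
    rw [interior_Icc] at hR
    rw [(hfd R hR).deriv]
    exact hfpos R hR
  obtain ⟨J, hJc, hJm, hJ0, hJ⟩ := hfm.exists_continuous_rightInverse hδ (by fun_prop) (by simp [f])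
  have hr : 0 < f δ := by
    have := hfm ⟨le_rfl, hδ.le⟩ ⟨hδ.le, le_rfl⟩ hδ
    simpa [f] using this
  have hJd : ∀ s ∈ Set.Ioo 0 (f δ), HasDerivAt J
      (Real.sin (φ (J s)) + Real.cos (φ (J s)) * Real.tan (y (J s)))⁻¹ s := by
    intro s hs
    refine HasDerivAt.of_local_left_inverse hJc.continuousAt (hfd _ (hJ s hs).1)
      (hfpos _ (hJ s hs).1).ne' ?_
    filter_upwards [isOpen_Ioo.mem_nhds hs] with t ht using (hJ t ht).2
  have hmaps : Set.MapsTo J (Set.Ioo 0 (f δ)) (Set.Ioo 0 δ) := fun s hs => (hJ s hs).1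
  have hJs : ContDiffOn ℝ ∞ J (Set.Ioo 0 (f δ)) := by
    refine contDiffOn_infty_of_hasDerivAt isOpen_Ioo hJd fun k hk => ?_
    have h1 : ContDiffOn ℝ k (fun s => φ (J s)) (Set.Ioo 0 (f δ)) :=
      (hφs.of_le (by exact_mod_cast le_top)).comp hk hmaps
    have h2 : ContDiffOn ℝ k (fun s => Real.tan (y (J s))) (Set.Ioo 0 (f δ)) := by
      intro s hs
      refine ContDiffAt.comp_contDiffWithinAt (g := Real.tan) s
        (Real.contDiffAt_tan.2 (hpos _ (hmaps hs)).2.2.1.ne') ?_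
      exact ((contDiffOn_const.mul (hk.pow 2)).sub (contDiffOn_const.mul h1)) s hs
    exact (h1.sin.add (h1.cos.mul h2)).inv fun s hs => (hfpos _ (hmaps hs)).ne'
  let h : ℝ → ℝ := fun s => J s * Real.cos (φ (J s))
  have hhd : ∀ s ∈ Set.Ioo 0 (f δ),
      HasDerivAt h (Real.tan (Real.pi / 2 - (φ (J s) + y (J s)))) s := by
    intro s hs
    obtain ⟨h1, h2, h3, h4⟩ := hpos _ (hmaps hs)
    have h5 := (hJ s hs).1.1.ne'
    refine ((hJd s hs).mul ((hφd _ (hmaps hs)).comp s (hJd s hs)).cos).congr_deriv ?_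
    have h6 := (hfpos _ (hmaps hs)).ne'
    have h7 : Real.tan (y (J s)) * Real.cos (y (J s)) = Real.sin (y (J s)) :=
      Real.tan_mul_cos h3.ne'
    have h8 : Real.cos (φ (J s) + y (J s)) =
        Real.cos (y (J s)) * (Real.cos (φ (J s)) - Real.sin (φ (J s)) * Real.tan (y (J s))) := by
      rw [Real.cos_add, ← h7]; ring
    have h9 : Real.sin (φ (J s) + y (J s)) =
        Real.cos (y (J s)) * (Real.sin (φ (J s)) + Real.cos (φ (J s)) * Real.tan (y (J s))) := by
      rw [Real.sin_add, ← h7]; ring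
    -- The slope is `cot (φ + y)`: the addition formulas, divided by `cos y`, produce the
    -- derivatives of `R cos φ` and `R sin φ`.
    rw [Real.tan_eq_sin_div_cos (Real.pi / 2 - _), Real.sin_pi_div_two_sub, Real.cos_pi_div_two_sub, h8, h9,
      mul_div_mul_left _ _ h3.ne']
    simp only [Function.comp_apply]
    field_simp
    ring
  have hquot : ∀ s ∈ Set.Ioo 0 (f δ), h s / s = Real.tan (Real.pi / 2 - φ (J s)) := by
    intro s hs
    have h5 := (hJ s hs).1.1.ne'
    have h6 : J s * Real.sin (φ (J s)) = s := (hJ s hs).2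
    have h7 : h s / s = J s * Real.cos (φ (J s)) / (J s * Real.sin (φ (J s))) := by rw [h6]
    rw [h7, mul_div_mul_left _ _ h5, Real.tan_eq_sin_div_cos, Real.sin_pi_div_two_sub,
      Real.cos_pi_div_two_sub]
  have hφm : MonotoneOn φ (Set.Icc 0 δ) := by
    apply monotoneOn_of_deriv_nonneg (convex_Icc 0 δ) hφc.continuousOn
    · rw [interior_Icc]
      exact fun R hR => (hφd R hR).differentiableAt.differentiableWithinAt
    · intro R hR
      rw [interior_Icc] at hR
      rw [(hφd R hR).deriv]
      exact div_nonneg (hpos R hR).2.2.2.le hR.1.le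
  refine ⟨f δ, hr, h, by fun_prop, by simp [h, hJ0], ?_, ?_, ?_, ?_, ?_⟩
  · exact hJs.mul (hφs.comp hJs hmaps).cos
  · intro s hs
    obtain ⟨-, h1, h2, h3⟩ := hφ _ (hIoc (hmaps hs))
    obtain ⟨-, h5, -, -⟩ := hpos _ (hmaps hs)
    have hJpos := (hJ s hs).1.1
    refine ⟨mul_pos hJpos (hpos _ (hmaps hs)).2.1, ?_, ?_⟩
    · rw [(hhd s hs).deriv]
      apply Real.tan_pos_of_pos_of_lt_pi_div_two <;> linarith [hy (J s)]
    · rw [(hhd s hs).deriv, hquot s hs, Real.arctan_tan, Real.arctan_tan]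
      · have h6 : s ^ 2 + h s ^ 2 = J s ^ 2 := by
          have := Real.sin_sq_add_cos_sq (φ (J s))
          have h7 : J s * Real.sin (φ (J s)) = s := (hJ s hs).2
          simp only [h]
          linear_combination J s ^ 2 * this - (s + J s * Real.sin (φ (J s))) * h7
        rw [h6]
        simp only [hy]
        ring
      all_goals linarith [hy (J s)]
  · intro s hs t ht hst
    simp only
    rw [hquot s hs, hquot t ht]
    have h1 := hφ _ (hIoc (hmaps hs))
    have h2 := hφ _ (hIoc (hmaps ht))
    have h3 : φ (J s) ≤ φ (J t) :=
      hφm ⟨(hmaps hs).1.le, (hmaps hs).2.le⟩ ⟨(hmaps ht).1.le, (hmaps ht).2.le⟩ (hJm.monotone hst)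
    apply Real.strictMonoOn_tan.monotoneOn
    · constructor <;> linarith
    · constructor <;> linarith
    · linarith
  -- With `R = J s`: `h ≤ R`, and `s = R sin φ ≥ R φ/2 ≥ c R³/2`, so `h³ ≤ (2/c) s`. The bound `sin
  -- φ ≥ φ/2` is Jordan's inequality with `π < 4`.
  · refine ⟨(2 / c) ^ (1 / 3 : ℝ), by positivity, fun s hs => ?_⟩
    obtain ⟨h0, h1, h2, h3⟩ := hφ _ (hIoc (hmaps hs))
    have hJpos := (hJ s hs).1.1
    have h4 : h s ≤ J s := mul_le_of_le_one_right hJpos.le (Real.cos_le_one _)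
    have h5 : 0 ≤ h s := (mul_pos hJpos (hpos _ (hmaps hs)).2.1).le
    have h6 : φ (J s) / 2 ≤ Real.sin (φ (J s)) := by
      refine le_trans ?_ (Real.mul_le_sin h1.le (by linarith))
      rw [div_mul_eq_mul_div, div_le_div_iff₀ (by norm_num) (by linarith)]
      nlinarith [Real.pi_lt_four]
    have h7 : h s ^ 3 ≤ 2 / c * s := by
      have h8 : J s * (c * J s ^ 2 / 2) ≤ s := by
        calc J s * (c * J s ^ 2 / 2) ≤ J s * Real.sin (φ (J s)) := by gcongr; linarith
          _ = s := (hJ s hs).2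
      have h9 : h s ^ 3 ≤ J s ^ 3 := pow_le_pow_left₀ h5 h4 3
      rw [div_mul_eq_mul_div, le_div_iff₀ hc]
      nlinarith
    rw [← Real.mul_rpow (by positivity) hs.1.le]
    calc h s = (h s ^ 3) ^ (1 / 3 : ℝ) := by
          rw [← Real.rpow_natCast, ← Real.rpow_mul h5]; norm_num
      _ ≤ _ := Real.rpow_le_rpow (by positivity) h7 (by norm_num)
  -- `h/s = cot φ`, and `φ` tends to 0 through positive values.
  · have h1 : Filter.Tendsto (fun s => Real.tan (φ (J s))) (𝓝[>] 0) (𝓝[>] 0) := by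
      apply tendsto_nhdsWithin_iff.2 ⟨?_, ?_⟩
      · have h2 : ContinuousAt (fun s => Real.tan (φ (J s))) 0 :=
          ContinuousAt.comp (g := Real.tan)
            (Real.continuousAt_tan.2 (by simp [hJ0, hφ0])) (by fun_prop)
        have h3 : Real.tan (φ (J 0)) = 0 := by simp [hJ0, hφ0]
        exact (h3 ▸ h2.tendsto).mono_left nhdsWithin_le_nhds
      · filter_upwards [Ioo_mem_nhdsGT hr] with s hs
        obtain ⟨-, h1, h2, h3⟩ := hφ _ (hIoc (hmaps hs))
        exact Real.tan_pos_of_pos_of_lt_pi_div_two h1 (by linarith)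
    refine h1.inv_tendsto_nhdsGT_zero.congr' ?_
    filter_upwards [Ioo_mem_nhdsGT hr] with s hs
    rw [hquot s hs, Real.tan_pi_div_two_sub]
    rfl

/-! ### Radial potentials: derivatives, convexity, Hölder gradient, singularity -/

/-- The rotationally symmetric function `U(|x|)` with `U' = h` and `U(0) = 0`. -/
noncomputable def radialPotential {E : Type*} [Norm E] (h : ℝ → ℝ) (x : E) : ℝ :=
  ∫ t in (0 : ℝ)..‖x‖, h t

theorem eventually_mul_norm_sq_le_radialPotential {F : Type*} [NormedAddCommGroup F]
    {h : ℝ → ℝ} (hc : Continuous h) (h0 : h 0 = 0)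
    (ht : Filter.Tendsto (fun s => h s / s) (𝓝[>] 0) Filter.atTop) (m : ℝ) :
    ∀ᶠ x : F in 𝓝 0, m / 2 * ‖x‖ ^ 2 ≤ radialPotential h x := by
  obtain ⟨ρ, hρ, hρm⟩ := mem_nhdsGT_iff_exists_Ioo_subset.1 (ht.eventually_ge_atTop m)
  filter_upwards [Metric.ball_mem_nhds (0 : F) hρ] with x hx
  rw [mem_ball_zero_iff] at hx
  have h1 : ∫ t in (0 : ℝ)..‖x‖, m * t = m / 2 * ‖x‖ ^ 2 := by
    rw [intervalIntegral.integral_const_mul, integral_id]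
    ring
  rw [← h1, radialPotential]
  apply intervalIntegral.integral_mono_on (norm_nonneg x)
  · exact Continuous.intervalIntegrable (by fun_prop) _ _
  · exact hc.intervalIntegrable _ _
  · intro t ht
    rcases ht.1.eq_or_lt with rfl | ht0
    · simp [h0]
    · exact (le_div_iff₀ ht0).1 (hρm ⟨ht0, ht.2.trans_lt hx⟩)

section Radial

variable {E : Type*} [NormedAddCommGroup E] [InnerProductSpace ℝ E]

theorem HasDerivAt.hasFDerivAt_comp_norm {g : ℝ → ℝ} {g' : ℝ} {x : E} (hx : x ≠ 0)
    (hg : HasDerivAt g g' ‖x‖) :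
    HasFDerivAt (fun y : E => g ‖y‖) ((g' / ‖x‖) • innerSL ℝ x) x := by
  have hx' : ‖x‖ ≠ 0 := norm_ne_zero_iff.2 hx
  have h1 : HasFDerivAt (fun y : E => ‖y‖) ((1 / ‖x‖) • innerSL ℝ x) x := by
    have h2 := (hasStrictFDerivAt_norm_sq x).hasFDerivAt.sqrt (pow_ne_zero 2 hx')
    simp only [Real.sqrt_sq (norm_nonneg _)] at h2
    refine h2.congr_fderiv ?_
    ext v
    simp
    field_simp
  refine (hg.comp_hasFDerivAt x h1).congr_fderiv ?_
  rw [smul_smul, mul_one_div]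

/-- The formula also covers the origin: there `U'(0) = h 0 = 0` makes the derivative zero, matching
the convention `0 / 0 = 0`. -/
theorem hasFDerivAt_radialPotential {h : ℝ → ℝ} (hc : Continuous h) (h0 : h 0 = 0) (x : E) :
    HasFDerivAt (radialPotential h) ((h ‖x‖ / ‖x‖) • innerSL ℝ x) x := by
  have hU : ∀ s, HasDerivAt (fun s => ∫ t in (0 : ℝ)..s, h t) (h s) s := fun s =>
    hc.integral_hasStrictDerivAt 0 s |>.hasDerivAt
  rcases eq_or_ne x 0 with rfl | hx
  · have h1 := hU 0
    rw [h0, hasDerivAt_iff_isLittleO_nhds_zero] at h1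
    simp only [norm_zero, h0, zero_div, zero_smul]
    rw [hasFDerivAt_iff_isLittleO_nhds_zero]
    have h2 : Filter.Tendsto (fun x : E => ‖x‖) (𝓝 0) (𝓝 0) := by
      simpa using (continuous_norm (E := E)).tendsto 0
    rw [← Asymptotics.isLittleO_norm_right]
    simpa [radialPotential, Function.comp_def] using h1.comp_tendsto h2
  · exact (hU ‖x‖).hasFDerivAt_comp_norm hx

theorem gradient_radialPotential [CompleteSpace E] {h : ℝ → ℝ} (hc : Continuous h) (h0 : h 0 = 0)
    (x : E) : gradient (radialPotential h) x = (h ‖x‖ / ‖x‖) • x := by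
  apply HasGradientAt.gradient
  rw [hasGradientAt_iff_hasFDerivAt]
  refine (hasFDerivAt_radialPotential hc h0 x).congr_fderiv ?_
  ext v
  simp

theorem contDiffOn_radialPotential {h : ℝ → ℝ} {r : ℝ} (hc : Continuous h)
    (hs : ContDiffOn ℝ ∞ h (Set.Ioo 0 r)) :
    ContDiffOn ℝ ∞ (radialPotential h) (Metric.ball (0 : E) r \ {0}) := by
  have hU : ContDiffOn ℝ ∞ (fun s => ∫ t in (0 : ℝ)..s, h t) (Set.Ioo 0 r) :=
    contDiffOn_infty_of_hasDerivAt isOpen_Ioo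
      (fun s _ => hc.integral_hasStrictDerivAt 0 s |>.hasDerivAt)
      fun k _ => hs.of_le (by exact_mod_cast le_top)
  refine hU.comp (fun x hx => (contDiffAt_norm ℝ hx.2).contDiffWithinAt) fun x hx => ?_
  exact ⟨norm_pos_iff.2 hx.2, by simpa using hx.1⟩

/-- `U` is convex and nondecreasing because `h` is nondecreasing and nonnegative, and it is composed
with the convex function `‖x‖`. -/
theorem convexOn_radialPotential {h : ℝ → ℝ} {r : ℝ} (hc : Continuous h)
    (h0 : h 0 = 0) (hm : MonotoneOn h (Set.Ico 0 r)) :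
    ConvexOn ℝ (Metric.ball (0 : E) r) (radialPotential h) := by
  have hd : ∀ s, HasDerivAt (fun s => ∫ t in (0 : ℝ)..s, h t) (h s) s := fun s =>
    hc.integral_hasStrictDerivAt 0 s |>.hasDerivAt
  have hdc : Continuous fun s => ∫ t in (0 : ℝ)..s, h t :=
    continuous_iff_continuousAt.2 fun s => (hd s).continuousAt
  have hderiv : deriv (fun s => ∫ t in (0 : ℝ)..s, h t) = h := funext fun s => (hd s).deriv
  have hconv : ConvexOn ℝ (Set.Ico 0 r) fun s => ∫ t in (0 : ℝ)..s, h t := by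
    apply MonotoneOn.convexOn_of_deriv (convex_Ico 0 r) hdc.continuousOn
    · exact fun s _ => (hd s).differentiableAt.differentiableWithinAt
    · rw [hderiv]
      exact hm.mono interior_subset
  have hmono : MonotoneOn (fun s => ∫ t in (0 : ℝ)..s, h t) (Set.Ico 0 r) := by
    apply monotoneOn_of_deriv_nonneg (convex_Ico 0 r) hdc.continuousOn
    · exact fun s _ => (hd s).differentiableAt.differentiableWithinAt
    · intro s hs
      have hs' := interior_subset hs
      rw [hderiv, ← h0]
      exact hm ⟨le_rfl, hs'.1.trans_lt hs'.2⟩ hs' hs'.1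
  refine ⟨convex_ball 0 r, fun x hx y hy a b ha hb hab => ?_⟩
  have hball : ∀ z ∈ Metric.ball (0 : E) r, ‖z‖ ∈ Set.Ico 0 r := fun z hz =>
    ⟨norm_nonneg z, by simpa using hz⟩
  refine le_trans ?_ (hconv.2 (hball x hx) (hball y hy) ha hb hab)
  refine hmono (hball _ (convex_ball 0 r hx hy ha hb hab))
    (convex_Ico 0 r (hball x hx) (hball y hy) ha hb hab) ?_
  refine (norm_add_le _ _).trans_eq ?_
  rw [norm_smul, norm_smul, Real.norm_of_nonneg ha, Real.norm_of_nonneg hb, smul_eq_mul,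
    smul_eq_mul]

/-- With `k(s) = h(s)/s`, split the difference as `k(|x|)(x - y) + (k(|x|) - k(|y|)) y`. Since `k`
decreases and `h` increases, the second term is at most `h(|x|) - k(|x|)|y| ≤ k(|x|)|x - y|`, like
the first. -/
theorem norm_radialField_sub_le {h : ℝ → ℝ} {r C : ℝ} (h0 : h 0 = 0)
    (hm : MonotoneOn h (Set.Ico 0 r)) (ha : AntitoneOn (fun s => h s / s) (Set.Ioo 0 r))
    (hC : ∀ s ∈ Set.Ioo 0 r, h s ≤ C * s ^ (1 / 3 : ℝ)) (hC0 : 0 ≤ C) {x y : E} (hx : ‖x‖ < r)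
    (hxy : ‖y‖ ≤ ‖x‖) :
    ‖(h ‖x‖ / ‖x‖) • x - (h ‖y‖ / ‖y‖) • y‖ ≤ 4 * C * ‖x - y‖ ^ (1 / 3 : ℝ) := by
  rcases (norm_nonneg x).eq_or_lt with hx0 | hx0
  · have hx' : x = 0 := norm_eq_zero.1 hx0.symm
    have hy' : y = 0 := norm_le_zero_iff.1 (by rwa [← hx0] at hxy)
    simp [hx', hy']
  have hxI : ‖x‖ ∈ Set.Ico 0 r := ⟨hx0.le, hx⟩
  have hnn : 0 ≤ h ‖x‖ := h0 ▸ hm ⟨le_rfl, hx0.trans hx⟩ hxI hx0.le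
  have hk : 0 ≤ h ‖x‖ / ‖x‖ := div_nonneg hnn hx0.le
  have hd : ‖x‖ - ‖y‖ ≤ ‖x - y‖ := norm_sub_norm_le x y
  have h1 : ‖(h ‖x‖ / ‖x‖ - h ‖y‖ / ‖y‖) • y‖ ≤ h ‖x‖ / ‖x‖ * ‖x - y‖ := by
    rcases (norm_nonneg y).eq_or_lt with hy0 | hy0
    · rw [norm_smul, ← hy0, mul_zero]
      positivity
    · have h2 := ha ⟨hy0, hxy.trans_lt hx⟩ ⟨hx0, hx⟩ hxy
      have h3 := hm ⟨hy0.le, hxy.trans_lt hx⟩ hxI hxy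
      dsimp only at h2
      rw [norm_smul, Real.norm_eq_abs, abs_sub_comm, abs_of_nonneg (by linarith), sub_mul,
        div_mul_cancel₀ _ hy0.ne']
      have h4 : h ‖x‖ = h ‖x‖ / ‖x‖ * ‖x‖ := (div_mul_cancel₀ _ hx0.ne').symm
      have h5 := mul_le_mul_of_nonneg_left hd hk
      nlinarith
  have h2 : ‖(h ‖x‖ / ‖x‖) • (x - y)‖ = h ‖x‖ / ‖x‖ * ‖x - y‖ := by
    rw [norm_smul, Real.norm_of_nonneg hk]
  have h3 : (h ‖x‖ / ‖x‖) • x - (h ‖y‖ / ‖y‖) • y =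
      (h ‖x‖ / ‖x‖) • (x - y) + (h ‖x‖ / ‖x‖ - h ‖y‖ / ‖y‖) • y := by
    module
  have h4 : ‖x - y‖ / (2 * ‖x‖) ≤ 1 := by
    rw [div_le_one (by positivity)]
    have := norm_sub_le x y
    linarith
  calc ‖(h ‖x‖ / ‖x‖) • x - (h ‖y‖ / ‖y‖) • y‖
      ≤ h ‖x‖ / ‖x‖ * ‖x - y‖ + h ‖x‖ / ‖x‖ * ‖x - y‖ := by
        rw [h3]
        exact (norm_add_le _ _).trans (add_le_add h2.le h1)
    -- The ratio is at most 1, so it may be replaced by its cube root; the powers of `‖x‖` then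
    -- cancel.
    _ = 4 * (h ‖x‖ * (‖x - y‖ / (2 * ‖x‖))) := by field_simp; ring
    _ ≤ 4 * (C * ‖x‖ ^ (1 / 3 : ℝ) * (‖x - y‖ / (2 * ‖x‖)) ^ (1 / 3 : ℝ)) := by
        gcongr
        · exact hC _ ⟨hx0, hx⟩
        · exact Real.self_le_rpow_of_le_one (by positivity) h4 (by norm_num)
    _ = 4 * C * (‖x - y‖ / 2) ^ (1 / 3 : ℝ) := by
        rw [mul_assoc C, ← Real.mul_rpow (by positivity) (by positivity), ← mul_assoc]
        congr 2
        field_simp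
    _ ≤ 4 * C * ‖x - y‖ ^ (1 / 3 : ℝ) := by
        gcongr
        linarith [norm_nonneg (x - y)]

theorem holderOnWith_of_dist_le {X Y : Type*} [PseudoMetricSpace X] [PseudoMetricSpace Y]
    {f : X → Y} {s : Set X} {C α : ℝ≥0}
    (h : ∀ x ∈ s, ∀ y ∈ s, dist (f x) (f y) ≤ C * dist x y ^ (α : ℝ)) : HolderOnWith C α f s := by
  intro x hx y hy
  rw [edist_dist, edist_dist, ENNReal.ofReal_rpow_of_nonneg dist_nonneg α.coe_nonneg,
    ← ENNReal.ofReal_coe_nnreal, ← ENNReal.ofReal_mul C.coe_nonneg]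
  exact ENNReal.ofReal_le_ofReal (h x hx y hy)

theorem holderOnWith_radialField {h : ℝ → ℝ} {r C : ℝ} (h0 : h 0 = 0)
    (hm : MonotoneOn h (Set.Ico 0 r)) (ha : AntitoneOn (fun s => h s / s) (Set.Ioo 0 r))
    (hC : ∀ s ∈ Set.Ioo 0 r, h s ≤ C * s ^ (1 / 3 : ℝ)) (hC0 : 0 ≤ C) :
    HolderOnWith (4 * C).toNNReal (1 / 3) (fun x : E => (h ‖x‖ / ‖x‖) • x) (Metric.ball 0 r) := by
  apply holderOnWith_of_dist_le
  intro x hx y hy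
  rw [Real.coe_toNNReal _ (by positivity), NNReal.coe_div, NNReal.coe_one, NNReal.coe_ofNat]
  rw [mem_ball_zero_iff] at hx hy
  rcases le_total ‖y‖ ‖x‖ with hxy | hxy
  · rw [dist_eq_norm, dist_eq_norm]
    exact norm_radialField_sub_le h0 hm ha hC hC0 hx hxy
  · rw [dist_comm, dist_comm x, dist_eq_norm, dist_eq_norm]
    exact norm_radialField_sub_le h0 hm ha hC hC0 hy hxy

/-- Differentiability at 0 would bound the field by `C‖x‖`, that is, `h(s)/s` by `C` near 0. -/
theorem not_differentiableAt_radialField [Nontrivial E] {h : ℝ → ℝ}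
    (ht : Filter.Tendsto (fun s => h s / s) (𝓝[>] 0) Filter.atTop) :
    ¬ DifferentiableAt ℝ (fun x : E => (h ‖x‖ / ‖x‖) • x) 0 := by
  intro hd
  obtain ⟨C, hC⟩ := hd.hasFDerivAt.isBigO_sub.bound
  obtain ⟨e, he⟩ := exists_norm_eq E zero_le_one
  have h1 : Filter.Tendsto (fun s : ℝ => s • e) (𝓝[>] 0) (𝓝 0) := by
    have : Filter.Tendsto (fun s : ℝ => s • e) (𝓝 0) (𝓝 ((0 : ℝ) • e)) :=
      (by fun_prop : Continuous fun s : ℝ => s • e).tendsto 0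
    rw [zero_smul] at this
    exact this.mono_left nhdsWithin_le_nhds
  obtain ⟨s, ⟨hs1, hs2⟩, hs3⟩ := ((h1.eventually hC).and
    (ht.eventually_gt_atTop (max C 0))).and self_mem_nhdsWithin |>.exists
  have hs0 : 0 < s := hs3
  have hk : 0 < h s / s := (le_max_right _ _).trans_lt hs2
  simp only [norm_smul, he, Real.norm_of_nonneg hs0.le, mul_one, smul_zero, sub_zero,
    Real.norm_of_nonneg hk.le] at hs1
  have := le_of_mul_le_mul_right hs1 hs0
  exact absurd ((le_max_left _ _).trans_lt hs2) (not_lt.2 this)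

/-- The second derivative of `U(|x|)` away from the origin, with `U' = h`. -/
theorem fderiv_fderiv_radialPotential {h : ℝ → ℝ} {h' : ℝ} (hc : Continuous h) (h0 : h 0 = 0)
    {x : E} (hx : x ≠ 0) (hd : HasDerivAt h h' ‖x‖) (v w : E) :
    fderiv ℝ (fderiv ℝ (radialPotential h)) x v w =
      h ‖x‖ / ‖x‖ * inner ℝ v w +
        (h' - h ‖x‖ / ‖x‖) / ‖x‖ ^ 2 * (inner ℝ x v * inner ℝ x w) := by
  have hx' : ‖x‖ ≠ 0 := norm_ne_zero_iff.2 hx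
  have h1 : fderiv ℝ (radialPotential h : E → ℝ) = fun y => (h ‖y‖ / ‖y‖) • innerSL ℝ y :=
    funext fun y => (hasFDerivAt_radialPotential hc h0 y).fderiv
  have h2 : HasFDerivAt (fun y : E => h ‖y‖ / ‖y‖) _ x :=
    (hd.div (hasDerivAt_id _) hx').hasFDerivAt_comp_norm hx
  have h3 := h2.fun_smul (innerSL ℝ (E := E)).hasFDerivAt
  rw [h1, h3.fderiv]
  have hi : ∀ a b : E, innerSL ℝ a b = inner ℝ a b := fun _ _ => rfl
  simp only [add_apply, smul_apply, ContinuousLinearMap.smulRight_apply, smul_eq_mul, id, hi]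
  field_simp

end Radial

/-! ### The viscosity solution -/

theorem lagrangianAngle_hessianMatrix_radialPotential {n : ℕ} (hn : 1 ≤ n) {h : ℝ → ℝ} {h' : ℝ}
    (hc : Continuous h) (h0 : h 0 = 0) {x : EuclideanSpace ℝ (Fin n)} (hx : x ≠ 0)
    (hd : HasDerivAt h h' ‖x‖) :
    lagrangianAngle (hessianMatrix (radialPotential h) x) =
      Real.arctan h' + (n - 1) * Real.arctan (h ‖x‖ / ‖x‖) := by
  have hx' : ‖x‖ ≠ 0 := norm_ne_zero_iff.2 hx
  have h1 : hessianMatrix (radialPotential h) x = Matrix.scalar (Fin n) (h ‖x‖ / ‖x‖) +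
      ((h' - h ‖x‖ / ‖x‖) / ‖x‖ ^ 2) • Matrix.vecMulVec x x := by
    ext i j
    rw [hessianMatrix, Matrix.of_apply, fderiv_fderiv_radialPotential hc h0 hx hd]
    simp [Matrix.vecMulVec_apply, Matrix.diagonal_apply, EuclideanSpace.inner_single_right,
      @eq_comm _ j i]
  rw [h1, lagrangianAngle_scalar_add_vecMulVec hn]
  have h2 : (x : Fin n → ℝ) ⬝ᵥ x = ‖x‖ ^ 2 := by
    rw [EuclideanSpace.real_norm_sq_eq]
    simp [dotProduct, sq]
  rw [h2, div_mul_cancel₀ _ (pow_ne_zero 2 hx'), add_sub_cancel]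

theorem gradient_eq_of_fderiv_eq {F : Type*} [NormedAddCommGroup F] [InnerProductSpace ℝ F]
    [CompleteSpace F] {f g : F → ℝ} {x : F} (h : fderiv ℝ f x = fderiv ℝ g x) :
    gradient f x = gradient g x := by
  rw [gradient, gradient, h]

/-- No `C²` function touches from above, at the origin, a radial potential whose profile has
infinite slope there. -/
theorem not_eventually_radialPotential_le {E : Type*} [NormedAddCommGroup E]
    [InnerProductSpace ℝ E] [Nontrivial E] {h : ℝ → ℝ} (hc : Continuous h) (h0 : h 0 = 0)
    (ht : Filter.Tendsto (fun s => h s / s) (𝓝[>] 0) Filter.atTop) {φ : E → ℝ}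
    (hφ : ContDiffAt ℝ 2 φ 0) (hφ0 : φ 0 = radialPotential h (0 : E)) :
    ¬ ∀ᶠ x in 𝓝 0, radialPotential h x ≤ φ x := by
  intro hle
  obtain ⟨e, he⟩ := exists_norm_eq E zero_le_one
  -- The paraboloid `m|x|²/2` lies below `u ≤ φ` and touches `φ` at 0, so its second derivative `m`
  -- in direction `e` could not exceed that of `φ`.
  set m := fderiv ℝ (fderiv ℝ φ) 0 e e + 1 with hm
  have h1 : fderiv ℝ (fun x : E => m / 2 * ‖x‖ ^ 2) = fun x => m • innerSL ℝ x := by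
    funext x
    refine (((hasStrictFDerivAt_norm_sq x).hasFDerivAt.const_mul (m / 2)).congr_fderiv ?_).fderiv
    ext v
    simp
    ring
  have h2 : fderiv ℝ (fderiv ℝ fun x : E => m / 2 * ‖x‖ ^ 2) 0 e e = m := by
    have h3 : HasFDerivAt (fun x : E => m • innerSL ℝ x) (m • innerSL ℝ) 0 :=
      (innerSL ℝ (E := E)).hasFDerivAt.const_smul m
    have hi : innerSL ℝ e e = (1 : ℝ) := by simp [he]
    rw [h1, h3.fderiv, smul_apply, smul_apply, smul_eq_mul, hi, mul_one]
  have h3 := fderiv_fderiv_le_of_eventually_le (f := fun x : E => m / 2 * ‖x‖ ^ 2) (g := φ) (x := 0)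
    (contDiff_const.mul (contDiff_norm_sq ℝ)).contDiffAt hφ
    (by simp [hφ0, radialPotential]) (by
      filter_upwards [hle, eventually_mul_norm_sq_le_radialPotential hc h0 ht m] with x h4 h5
        using h5.trans h4) e
  rw [h2] at h3
  linarith

theorem proposition6p1 (n : ℕ) (hn : 1 ≤ n) (a : ℝ) (ha : a < 0) (c : ℝ)
    (hc : c = n * Real.pi / 2) :
    ∃ r : ℝ, 0 < r ∧ ∃ u : EuclideanSpace ℝ (Fin n) → ℝ,
      IsViscositySolution (rotatorPhase a c) (Metric.ball 0 r) u ∧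
      ConvexOn ℝ (Metric.ball 0 r) u ∧
      IsC1Holder (1 / 3) (Metric.ball 0 r) u ∧
      ContDiffOn ℝ ∞ u (Metric.ball 0 r \ {0}) ∧
      ¬ DifferentiableAt ℝ (gradient u) 0 := by
  obtain ⟨r, hr, h, hhc, hh0, hhs, hode, hanti, ⟨C, hC0, hC⟩, htop⟩ :=
    exists_profile hn (β := -a / 2) (by linarith)
  have : Nonempty (Fin n) := ⟨⟨0, hn⟩⟩
  have hhm : MonotoneOn h (Set.Ico 0 r) := by
    apply monotoneOn_of_deriv_nonneg (convex_Ico 0 r) hhc.continuousOn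
    · rw [interior_Ico]
      exact hhs.differentiableOn (by simp)
    · rw [interior_Ico]
      exact fun s hs => (hode s hs).2.1.le
  set u : EuclideanSpace ℝ (Fin n) → ℝ := radialPotential h with hu
  have hud : ∀ x, HasFDerivAt u ((h ‖x‖ / ‖x‖) • innerSL ℝ x) x :=
    hasFDerivAt_radialPotential hhc hh0
  have hgrad : gradient u = fun x => (h ‖x‖ / ‖x‖) • x :=
    funext fun x => gradient_radialPotential hhc hh0 x
  have hholder : HolderOnWith (4 * C).toNNReal (1 / 3) (gradient u) (Metric.ball 0 r) := by
    rw [hgrad]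
    exact holderOnWith_radialField hh0 hhm hanti hC hC0
  have hus : ContDiffOn ℝ ∞ u (Metric.ball 0 r \ {0}) := contDiffOn_radialPotential hhc hhs
  have hopen : IsOpen (Metric.ball (0 : EuclideanSpace ℝ (Fin n)) r \ {0}) :=
    Metric.isOpen_ball.sdiff isClosed_singleton
  have hu2 : ∀ x ∈ Metric.ball (0 : EuclideanSpace ℝ (Fin n)) r \ {0}, ContDiffAt ℝ 2 u x :=
    fun x hx => (contDiffOn_infty.1 hus 2).contDiffAt (hopen.mem_nhds hx)
  have hsol : ∀ x ∈ Metric.ball (0 : EuclideanSpace ℝ (Fin n)) r \ {0},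
      lagrangianAngle (hessianMatrix u x) = rotatorPhase a c x (u x) (gradient u x) := by
    intro x hx
    have hx0 : 0 < ‖x‖ := norm_pos_iff.2 hx.2
    have hxI : ‖x‖ ∈ Set.Ioo 0 r := ⟨hx0, mem_ball_zero_iff.1 hx.1⟩
    have hd : HasDerivAt h (deriv h ‖x‖) ‖x‖ :=
      ((hhs.contDiffAt (isOpen_Ioo.mem_nhds hxI)).differentiableAt (by simp)).hasDerivAt
    rw [lagrangianAngle_hessianMatrix_radialPotential hn hhc hh0 hx.2 hd, (hode _ hxI).2.2,
      rotatorPhase, hc, hgrad, norm_smul, Real.norm_of_nonneg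
        (div_nonneg (hode _ hxI).1.le hx0.le), div_mul_cancel₀ _ hx0.ne']
    ring
  have hgrad_eq : ∀ {φ : EuclideanSpace ℝ (Fin n) → ℝ} {x}, ContDiffAt ℝ 2 φ x → φ x = u x →
      ((∀ᶠ y in 𝓝 x, u y ≤ φ y) ∨ ∀ᶠ y in 𝓝 x, φ y ≤ u y) → gradient φ x = gradient u x := by
    rintro φ x hφ hx (hle | hle)
    · exact (gradient_eq_of_fderiv_eq (fderiv_eq_of_eventually_le (hud x).differentiableAt
        (hφ.differentiableAt (by norm_num)) hx.symm hle)).symm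
    · exact gradient_eq_of_fderiv_eq (fderiv_eq_of_eventually_le
        (hφ.differentiableAt (by norm_num)) (hud x).differentiableAt hx hle)
  refine ⟨r, hr, u, ⟨fun x _ => (hud x).continuousAt.continuousWithinAt, ?_, ?_⟩,
    convexOn_radialPotential hhc hh0 hhm, ⟨?_, _, hholder⟩, hus, ?_⟩
  · intro x hx φ hφ hφx hle
    rcases eq_or_ne x 0 with rfl | hx0
    · exact absurd hle (not_eventually_radialPotential_le hhc hh0 htop hφ hφx)
    · rw [hgrad_eq hφ hφx (Or.inl hle), ← hsol x ⟨hx, hx0⟩]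
      exact lagrangianAngle_hessianMatrix_le (hu2 x ⟨hx, hx0⟩) hφ hφx.symm hle
  · intro x hx φ hφ hφx hle
    rw [hgrad_eq hφ hφx (Or.inr hle)]
    rcases eq_or_ne x 0 with rfl | hx0
    -- At the origin the gradient vanishes and the phase is `c = nπ/2`, the upper bound of every
    -- Lagrangian angle.
    · simpa [rotatorPhase, hgrad, hc] using lagrangianAngle_le (hessianMatrix φ 0)
    · rw [← hsol x ⟨hx, hx0⟩]
      exact lagrangianAngle_hessianMatrix_le hφ (hu2 x ⟨hx, hx0⟩) hφx hle
  · rw [show (1 : WithTop ℕ∞) = 0 + 1 by simp, contDiffOn_succ_iff_fderiv_of_isOpen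
      Metric.isOpen_ball]
    refine ⟨fun x _ => (hud x).differentiableAt.differentiableWithinAt, by simp, ?_⟩
    rw [contDiffOn_zero, ← toDual_comp_gradient]
    exact (InnerProductSpace.toDual ℝ _).continuous.comp_continuousOn
      (hholder.continuousOn (by norm_num))
  · rw [hgrad]
    exact not_differentiableAt_radialField htop
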